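/- Let $V$ be a finite-dimensional real inner product space and let $\Phi\subseteq V$ be an irreducible (reduced, crystallographic) root system that is simply laced, i.e. all roots have the same length. Write $\alpha^\vee=2\alpha/\langle\alpha,\alpha\rangle$, let $W$ be the Weyl group, fix simple roots $\alpha_1,\dots,\alpha_n$ with positive roots $\Phi^+$, and let $Q$ and $P=\{v\in V:\langle v,\alpha^\vee\rangle\in\mathbb{Z}\text{ for all }\alpha\in\Phi\}$ be the root and weight lattices. Let $\omega_1,\dots,\omega_n$ be the fundamental weights, defined by $\langle\omega_i,\alpha_j^\vee\rangle=\delta_{ij}$, and let $\rho=\sum_{i=1}^n\omega_i$. For $\mu\in P$ let $\Pi(\mu)$ be the convex hull of the orbit $W\mu$, let $\Pi^{Q}(\mu)=\Pi(\mu)\cap(Q+\mu)$, let $\Pi^\circ(\mu)$ be the topological interior of $\Pi(\mu)$ in $V$, and let $\Pi^{\circ,Q}(\mu)=\Pi^\circ(\mu)\cap(Q+\mu)$. A nonzero weight $\mu\in P$ is minuscule if it is dominant (that is, $\langle\mu,\alpha_i^\vee\rangle\ge 0$ for all $i$) and $\Pi^Q(\mu)=W\mu$. Let $\Omega_m^0$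 be the set consisting of $0$ and all minuscule weights. Central-firing is the relation on $P$ given by $\mu\to\mu+\alpha$ whenever $\mu\in P$ and $\alpha\in\Phi^+$ satisfy $\langle\mu,\alpha^\vee\rangle=0$; let $\xrightarrow{*}$ be its reflexive transitive closure. A weight $\lambda\in P$ is connected if $\operatorname{Span}_{\mathbb{R}}\{\lambda-\mu:\lambda\xrightarrow{*}\mu\}=V$. Then every weight $\lambda\in P$ such that $\lambda\in\Pi^{\circ,Q}(\rho+\omega)$ for some $\omega\in\Omega_m^0$ is connected. -/

import Mathlib

open Set
open scoped InnerProductSpace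

noncomputable section

namespace CentralFiring

section Lattices

variable {ι V N : Type*} [AddCommGroup V] [Module ℝ V] [AddCommGroup N] [Module ℝ N]

/-- The weight lattice: the vectors whose pairing with every coroot is an integer. -/
def weightLattice (Φ : RootPairing ι ℝ V N) : AddSubgroup V where
  carrier := {v | ∀ i, ∃ z : ℤ, Φ.coroot' i v = z}
  zero_mem' := fun i => ⟨0, by simp⟩
  add_mem' := by
    intro v w hv hw i
    obtain ⟨a, ha⟩ := hv i
    obtain ⟨b, hb⟩ := hw i
    exact ⟨a + b, by rw [map_add, ha, hb, Int.cast_add]⟩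
  neg_mem' := by
    intro v hv i
    obtain ⟨a, ha⟩ := hv i
    exact ⟨-a, by rw [map_neg, ha, Int.cast_neg]⟩

/-- The root lattice: all integer combinations of roots. -/
def rootLattice (Φ : RootPairing ι ℝ V N) : AddSubgroup V :=
  AddSubgroup.closure (range Φ.root)

/-- The permutohedron of `μ`: the convex hull of the Weyl group orbit of `μ`. -/
def permutohedron (Φ : RootPairing ι ℝ V N) (μ : V) : Set V :=
  convexHull ℝ (MulAction.orbit Φ.weylGroup μ)

/-- The points of the permutohedron of `μ` that are congruent to `μ` modulo the root lattice. -/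
def permutohedronLattice (Φ : RootPairing ι ℝ V N) (μ : V) : Set V :=
  {ν | ν ∈ permutohedron Φ μ ∧ μ - ν ∈ rootLattice Φ}

end Lattices

section Weights

variable {ι V N : Type*} [AddCommGroup V] [Module ℝ V] [AddCommGroup N] [Module ℝ N]
  {Φ : RootPairing ι ℝ V N}

/-- A vector is dominant if it pairs nonnegatively with every simple coroot. -/
def IsDominant (Δ : Φ.Base) (v : V) : Prop :=
  ∀ i ∈ Δ.support, 0 ≤ Φ.coroot' i v

/-- A minuscule weight: a nonzero dominant weight `μ` such that the points of its permutohedron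
congruent to `μ` modulo the root lattice are exactly the points of its Weyl group orbit. -/
def IsMinuscule (Δ : Φ.Base) (μ : V) : Prop :=
  μ ∈ weightLattice Φ ∧ μ ≠ 0 ∧ IsDominant Δ μ ∧
    permutohedronLattice Φ μ = MulAction.orbit Φ.weylGroup μ

/-- The fundamental weights: the basis dual to the basis of simple coroots. -/
def fundamentalWeight [Φ.IsRootSystem] (Δ : Φ.Base) (i : Δ.support) : V :=
  Φ.toPerfPair.symm (Δ.toCoweightBasis.coord i)

theorem coroot_fundamentalWeight [Φ.IsRootSystem] [DecidableEq ι] (Δ : Φ.Base)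
    (i j : Δ.support) :
    Φ.coroot' j (fundamentalWeight Δ i) = if i = j then 1 else 0 := by
  have h : Φ.toLinearMap (fundamentalWeight Δ i) = Δ.toCoweightBasis.coord i :=
    Φ.toLinearMap.apply_symm_toPerfPair_self _
  rw [RootPairing.coroot', LinearMap.flip_apply, h, ← Δ.toCoweightBasis_apply j,
    Module.Basis.coord_apply, Module.Basis.repr_self, Finsupp.single_apply]
  simp only [eq_comm]

/-- The Weyl vector: the sum of the fundamental weights. -/
def weylVector [Φ.IsRootSystem] (Δ : Φ.Base) : V :=
  ∑ i : Δ.support, fundamentalWeight Δ i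

/-- Central-firing on weights: `μ → μ + α` whenever `α` is a positive root whose coroot vanishes
at `μ`. -/
def Fires (Δ : Φ.Base) (μ ν : weightLattice Φ) : Prop :=
  ∃ i, Δ.IsPos i ∧ Φ.coroot' i (μ : V) = 0 ∧ (ν : V) = (μ : V) + Φ.root i

/-- The firing span of a weight: the real span of all differences `μ - ν`, where `ν` is reachable
from `μ` by a finite (possibly empty) sequence of firing moves. -/
def firingSpan (Δ : Φ.Base) (μ : weightLattice Φ) : Submodule ℝ V :=
  Submodule.span ℝ {v | ∃ ν, Relation.ReflTransGen (Fires Δ) μ ν ∧ v = (μ : V) - (ν : V)}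

/-- A weight is connected if its firing span is the whole space. -/
def IsConnectedWeight (Δ : Φ.Base) (μ : weightLattice Φ) : Prop :=
  firingSpan Δ μ = ⊤

end Weights

section Euclidean

variable {ι V N : Type*} [NormedAddCommGroup V] [InnerProductSpace ℝ V]
  [AddCommGroup N] [Module ℝ N]

/-- The coroots are those given by the inner product of the ambient space, that is, the coroot of
`α` is the functional `v ↦ 2⟨α, v⟩ / ⟨α, α⟩`, so that the reflections are orthogonal. -/
def IsEuclidean (Φ : RootPairing ι ℝ V N) : Prop :=
  ∀ (i : ι) (v : V), Φ.coroot' i v = 2 * ⟪Φ.root i, v⟫_ℝ / ⟪Φ.root i, Φ.root i⟫_ℝ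

/-- All roots have the same length. -/
def IsSimplyLaced (Φ : RootPairing ι ℝ V N) : Prop :=
  ∀ i j : ι, ‖Φ.root i‖ = ‖Φ.root j‖

/-- The points in the topological interior of the permutohedron of `μ` that are congruent to `μ`
modulo the root lattice. -/
def interiorPermutohedronLattice (Φ : RootPairing ι ℝ V N) (μ : V) : Set V :=
  {ν | ν ∈ interior (permutohedron Φ μ) ∧ ν - μ ∈ rootLattice Φ}

end Euclidean

end CentralFiring

end

open Set
open scoped InnerProductSpace

noncomputable section

namespace CentralFiring

variable {ι V N : Type*} [AddCommGroup V] [Module ℝ V] [AddCommGroup N] [Module ℝ N]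

/-! Since all roots have the same length, the inner product can be rescaled so that each root
represents its own coroot; all estimates use this `RootForm`.

Firing spans may be computed with all roots instead of the positive ones and transported by the Weyl
group (`smul_mem_firingSpan`): a move along a root orthogonal to `x` can be replaced by the opposite
one, because the reflection in that root fixes `x`. Hence the weight may be assumed dominant.
Pairing with the fundamental weights then turns membership in the interior into the form `x = ρ + ω
- ∑ cᵢ αᵢ` with every `cᵢ > 0`.

The core is `root_mem_unsignedSpan_of_dominant`: for such a dominant `x`, each `αᵢ` with `cᵢ ≠ 0`
lies in the span. If no coroot vanished at `x`, then `ω - ∑ cᵢ αᵢ` would be dominant, which forces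
`c = 0` because `ω` is zero or minuscule. So some root is orthogonal to `x`; one of maximal height
keeps `x` dominant when fired. Its simple constituents are themselves orthogonal to `x` and can be
fired at once, and the other simple roots are handled by induction on `∑ cᵢ` after the move. -/

/-- A positive definite symmetric bilinear form through which every root represents its own
coroot. -/
structure RootForm (Φ : RootPairing ι ℝ V N) where
  /-- The underlying bilinear form. -/
  form : V →ₗ[ℝ] V →ₗ[ℝ] ℝ
  symm : ∀ x y, form x y = form y x
  pos : ∀ x, x ≠ 0 → 0 < form x x
  root_apply : ∀ i v, form (Φ.root i) v = Φ.coroot' i v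

/-- The linear combination of the simple roots with the given coefficients. -/
def comb {Φ : RootPairing ι ℝ V N} (Δ : Φ.Base) : (Δ.support → ℝ) →ₗ[ℝ] V :=
  Fintype.linearCombination ℝ fun i : Δ.support => Φ.root i

theorem comb_apply {Φ : RootPairing ι ℝ V N} (Δ : Φ.Base) (c : Δ.support → ℝ) :
    comb Δ c = ∑ i, c i • Φ.root i :=
  Fintype.linearCombination_apply ..

/-! ### Invariance of the form, lattices and Weyl orbits -/

section Form

variable {Φ : RootPairing ι ℝ V N} (B : RootForm Φ) (Δ : Φ.Base)

theorem RootForm.eq_zero {x : V} (h : B.form x x ≤ 0) : x = 0 := by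
  by_contra hx
  exact absurd (B.pos x hx) h.not_gt

theorem coroot'_root_self (i : ι) : Φ.coroot' i (Φ.root i) = 2 := by
  rw [RootPairing.root_coroot'_eq_pairing, RootPairing.pairing_same]

theorem RootForm.form_add_self (x y : V) :
    B.form (x + y) (x + y) = B.form x x + 2 * B.form x y + B.form y y := by
  simp only [map_add, LinearMap.add_apply]
  rw [B.symm y x]
  ring

theorem RootForm.form_reflection (i : ι) (x y : V) :
    B.form (Φ.reflection i x) (Φ.reflection i y) = B.form x y := by
  simp only [RootPairing.reflection_apply, map_sub, map_smul, LinearMap.sub_apply,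
    LinearMap.smul_apply, smul_eq_mul, B.root_apply, coroot'_root_self]
  rw [B.symm x (Φ.root i), B.root_apply]
  ring

theorem RootForm.form_smul_smul (w : Φ.weylGroup) (x y : V) :
    B.form (w • x) (w • y) = B.form x y := by
  revert x y
  obtain ⟨g, hg⟩ := w
  induction hg using RootPairing.weylGroup.induction with
  | mem i => exact fun x y => B.form_reflection i x y
  | one => exact fun x y => rfl
  | mul g₁ g₂ hg₁ hg₂ h₁ h₂ =>
    intro x y
    rw [← Submonoid.mk_mul_mk _ _ _ hg₁ hg₂, mul_smul, mul_smul, h₁, h₂]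

theorem RootForm.form_smul (w : Φ.weylGroup) (x y : V) :
    B.form (w • x) y = B.form x (w⁻¹ • y) := by
  rw [← B.form_smul_smul w x, smul_inv_smul]

theorem RootForm.exists_coroot'_smul (B : RootForm Φ) (w : Φ.weylGroup) (i : ι) :
    ∃ j, ∀ x, Φ.coroot' i (w • x) = Φ.coroot' j x := by
  refine ⟨Φ.weylGroupToPerm w⁻¹ i, fun x => ?_⟩
  rw [← B.root_apply, ← B.root_apply, ← RootPairing.weylGroup_apply_root, B.form_smul, inv_inv]

theorem ofIdx_smul_eq (i : ι) (x : V) :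
    RootPairing.weylGroup.ofIdx Φ i • x = x - Φ.coroot' i x • Φ.root i := by
  rw [← RootPairing.reflection_apply]
  rfl

theorem RootForm.form_comb (c : Δ.support → ℝ) (x : V) :
    B.form (comb Δ c) x = ∑ i, c i * Φ.coroot' i x := by
  simp [comb_apply, B.root_apply]

theorem coroot'_comb (c : Δ.support → ℝ) (i : ι) :
    Φ.coroot' i (comb Δ c) = ∑ j, c j * Φ.coroot' i (Φ.root j) := by
  simp only [comb_apply, map_sum, map_smul, smul_eq_mul]

theorem comb_injective : Function.Injective (comb Δ) :=
  LinearIndependent.fintypeLinearCombination_injective Δ.linearIndepOn_root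

theorem comb_single [DecidableEq ι] (i : Δ.support) : comb Δ (Pi.single i 1) = Φ.root i := by
  simp [comb]

theorem exists_root_eq_comb (i : ι) : ∃ m : Δ.support → ℕ,
    Φ.root i = comb Δ (fun j => m j) ∨ Φ.root i = -comb Δ (fun j => m j) := by
  obtain ⟨f, -, h⟩ := Δ.exists_root_eq_sum_nat_or_neg i
  refine ⟨fun j => f j, ?_⟩
  rw [comb_apply]
  simpa only [Nat.cast_smul_eq_nsmul, Finset.sum_coe_sort Δ.support (fun j => f j • Φ.root j)]
    using h

theorem exists_comb_of_mem_rootLattice {x : V} (hx : x ∈ rootLattice Φ) :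
    ∃ d : Δ.support → ℤ, x = comb Δ (fun j => d j) := by
  induction hx using AddSubgroup.closure_induction with
  | mem x hx =>
    obtain ⟨i, rfl⟩ := hx
    obtain ⟨m, h | h⟩ := exists_root_eq_comb Δ i
    · exact ⟨fun j => m j, by simpa using h⟩
    · exact ⟨fun j => -m j, by rw [h, ← map_neg]; congr 1; ext j; simp⟩
  | zero => exact ⟨0, by simp [comb_apply]⟩
  | add x y _ _ hx hy =>
    obtain ⟨a, rfl⟩ := hx
    obtain ⟨b, rfl⟩ := hy
    exact ⟨a + b, by rw [← map_add]; congr 1; ext j; simp⟩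
  | neg x _ hx =>
    obtain ⟨a, rfl⟩ := hx
    exact ⟨-a, by rw [← map_neg]; congr 1; ext j; simp⟩

theorem root_mem_rootLattice (i : ι) : Φ.root i ∈ rootLattice Φ :=
  AddSubgroup.subset_closure ⟨i, rfl⟩

theorem comb_mem_rootLattice (d : Δ.support → ℤ) : comb Δ (fun j => d j) ∈ rootLattice Φ := by
  rw [comb_apply]
  refine sum_mem fun i _ => ?_
  rw [Int.cast_smul_eq_zsmul]
  exact zsmul_mem (root_mem_rootLattice _) _

theorem rootLattice_le_weightLattice [Φ.IsCrystallographic] :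
    rootLattice Φ ≤ weightLattice Φ := by
  refine (AddSubgroup.closure_le _).2 ?_
  rintro _ ⟨i, rfl⟩ j
  exact ⟨Φ.pairingIn ℤ i j, by
    rw [RootPairing.root_coroot'_eq_pairing, ← Φ.algebraMap_pairingIn ℤ i j]; rfl⟩

theorem smul_sub_mem_rootLattice [Φ.IsCrystallographic] (w : Φ.weylGroup) {x : V}
    (hx : x ∈ weightLattice Φ) : w • x - x ∈ rootLattice Φ := by
  revert x
  obtain ⟨g, hg⟩ := w
  induction hg using RootPairing.weylGroup.induction with
  | mem i =>
    intro x hx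
    obtain ⟨z, hz⟩ := hx i
    have := ofIdx_smul_eq (Φ := Φ) i x
    rw [hz, Int.cast_smul_eq_zsmul] at this
    change RootPairing.weylGroup.ofIdx Φ i • x - x ∈ _
    rw [this, sub_sub_cancel_left]
    exact neg_mem (zsmul_mem (root_mem_rootLattice i) z)
  | one =>
    intro x _
    change x - x ∈ _
    simp
  | mul g₁ g₂ hg₁ hg₂ h₁ h₂ =>
    intro x hx
    rw [← Submonoid.mk_mul_mk _ _ _ hg₁ hg₂, mul_smul]
    have h := h₂ hx
    have hy : (⟨g₂, hg₂⟩ : Φ.weylGroup) • x ∈ weightLattice Φ := by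
      simpa using add_mem (rootLattice_le_weightLattice h) hx
    simpa using add_mem (h₁ hy) h

theorem smul_mem_weightLattice [Φ.IsCrystallographic] (w : Φ.weylGroup) {x : V}
    (hx : x ∈ weightLattice Φ) : w • x ∈ weightLattice Φ := by
  simpa using add_mem (rootLattice_le_weightLattice (smul_sub_mem_rootLattice w hx)) hx

/-- The roots span, so a Weyl element acts on `x` through its permutation of the finitely many
roots. -/
theorem finite_orbit [Finite ι] [Φ.IsRootSystem] (x : V) :
    (MulAction.orbit Φ.weylGroup x).Finite := by
  have key : ∀ u w : Φ.weylGroup, Φ.weylGroupToPerm u = Φ.weylGroupToPerm w → u • x = w • x := by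
    intro u w h
    have hx : x ∈ Submodule.span ℝ (range Φ.root) := by
      rw [RootPairing.IsRootSystem.span_root_eq_top (P := Φ)]; trivial
    induction hx using Submodule.span_induction with
    | mem x hx =>
      obtain ⟨i, rfl⟩ := hx
      rw [RootPairing.weylGroup_apply_root, RootPairing.weylGroup_apply_root, h]
    | zero => rw [smul_zero, smul_zero]
    | add x y _ _ hx hy => rw [smul_add, smul_add, hx, hy]
    | smul a x _ hx => rw [smul_comm u a x, smul_comm w a x, hx]
  have hs : ∀ z : MulAction.orbit Φ.weylGroup x, ∃ u : Φ.weylGroup, u • x = z := fun z => z.2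
  choose f hf using hs
  refine Finite.of_injective (fun z => Φ.weylGroupToPerm (f z)) fun y z h => Subtype.ext ?_
  rw [← hf y, ← hf z]
  exact key _ _ h
  
end Form

/-! ### Dominant vectors and nonnegative combinations of simple roots -/

section Dominance

variable {Φ : RootPairing ι ℝ V N} (Δ : Φ.Base)

theorem coroot'_root_nonpos_of_ne [Finite ι] [Φ.IsCrystallographic] {i j : Δ.support}
    (h : i ≠ j) : Φ.coroot' i (Φ.root j) ≤ 0 := by
  rw [RootPairing.root_coroot'_eq_pairing, ← Φ.algebraMap_pairingIn ℤ, eq_intCast]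
  exact_mod_cast Δ.pairingIn_le_zero_of_ne (fun e => h (Subtype.ext e.symm)) j.2 i.2

theorem coroot'_comb_nonpos [Finite ι] [Φ.IsCrystallographic] {c : Δ.support → ℝ}
    (hc : ∀ j, 0 ≤ c j) {i : Δ.support} (hi : c i = 0) : Φ.coroot' i (comb Δ c) ≤ 0 := by
  rw [coroot'_comb]
  refine Finset.sum_nonpos fun j _ => ?_
  rcases eq_or_ne i j with rfl | h
  · simp [hi]
  · exact mul_nonpos_of_nonneg_of_nonpos (hc j) (coroot'_root_nonpos_of_ne Δ h)

/-- Distinct simple roots pair nonpositively, so `d⁻` pairs nonpositively with `d⁺`. The hypothesis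
makes `d⁻` pair nonnegatively with `d = d⁺ - d⁻`, so `d⁻` has norm zero. -/
theorem RootForm.nonneg_of_coroot'_comb_nonneg (B : RootForm Φ) [Finite ι]
    [Φ.IsCrystallographic] {d : Δ.support → ℝ}
    (h : ∀ i, d i < 0 → 0 ≤ Φ.coroot' i (comb Δ d)) (i : Δ.support) : 0 ≤ d i := by
  have hd : d = d⁺ - d⁻ := (posPart_sub_negPart d).symm
  have hcross : B.form (comb Δ d⁻) (comb Δ d⁺) ≤ 0 := by
    rw [B.form_comb]
    refine Finset.sum_nonpos fun j _ => ?_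
    rcases le_total 0 (d j) with hj | hj
    · simp [Pi.negPart_apply, negPart_eq_zero.2 hj]
    · refine mul_nonpos_of_nonneg_of_nonpos (negPart_nonneg _)
        (coroot'_comb_nonpos Δ (fun k => posPart_nonneg _) ?_)
      simp [posPart_eq_zero.2 hj]
  have hnn : 0 ≤ B.form (comb Δ d⁻) (comb Δ d) := by
    rw [B.form_comb]
    refine Finset.sum_nonneg fun j _ => ?_
    rcases le_or_gt 0 (d j) with hj | hj
    · simp [Pi.negPart_apply, negPart_eq_zero.2 hj]
    · exact mul_nonneg (negPart_nonneg _) (h j hj)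
  have hz : comb Δ d⁻ = 0 := by
    refine B.eq_zero ?_
    have e : comb Δ d = comb Δ d⁺ - comb Δ d⁻ := by rw [← map_sub, ← hd]
    rw [e, map_sub] at hnn
    linarith
  have : d⁻ = 0 := comb_injective Δ (by rw [hz, map_zero])
  exact negPart_eq_zero.1 (congrFun this i)

theorem RootForm.form_comb_nonneg (B : RootForm Φ) {c : Δ.support → ℝ} (hc : ∀ j, 0 ≤ c j) {x : V}
    (hx : IsDominant Δ x) : 0 ≤ B.form x (comb Δ c) := by
  rw [B.symm, B.form_comb]
  exact Finset.sum_nonneg fun j _ => mul_nonneg (hc j) (hx j j.2)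

/-- A vector whose pairing with every simple coroot is `1`. -/
def IsUnitWeight (ρ : V) : Prop :=
  ∀ i : Δ.support, Φ.coroot' i ρ = 1

theorem RootForm.exists_dominant_smul (B : RootForm Φ) [Finite ι] [Φ.IsRootSystem] {ρ v : V}
    (hρ : IsUnitWeight Δ ρ) (hv : IsDominant Δ v) (y : V) :
    ∃ u : Φ.weylGroup, IsDominant Δ (u • y) ∧ B.form v y ≤ B.form v (u • y) := by
  -- Reflecting in a simple root with negative pairing never lowers the pairing with `v` and
  -- strictly raises the one with `ρ`; the lexicographic order breaks ties.
  let f : V → ℝ ×ₗ ℝ := fun z => toLex (B.form v z, B.form ρ z)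
  obtain ⟨_, ⟨u, rfl⟩, hu⟩ := Set.exists_max_image (MulAction.orbit Φ.weylGroup y) f
    (finite_orbit y) ⟨y, MulAction.mem_orbit_self y⟩
  refine ⟨u, fun i hi => ?_, ?_⟩
  · by_contra! hneg
    have h := hu (RootPairing.weylGroup.ofIdx Φ i • u • y)
      (by rw [← mul_smul]; exact MulAction.mem_orbit _ _)
    simp only [f, ofIdx_smul_eq, Prod.Lex.toLex_le_toLex, map_sub, map_smul, smul_eq_mul] at h
    rw [B.symm v (Φ.root i), B.symm ρ (Φ.root i), B.root_apply, B.root_apply, hρ ⟨i, hi⟩] at h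
    have := mul_nonpos_of_nonpos_of_nonneg hneg.le (hv i hi)
    rcases h with h | ⟨-, h⟩ <;> linarith
  · have h := hu y (MulAction.mem_orbit_self y)
    simp only [f, Prod.Lex.toLex_le_toLex] at h
    rcases h with h | ⟨h, -⟩
    · exact h.le
    · exact h.le

theorem RootForm.exists_coroot'_comb_pos (B : RootForm Φ) {c : Δ.support → ℕ} (hc : c ≠ 0) :
    ∃ i : Δ.support, c i ≠ 0 ∧ 0 < Φ.coroot' i (comb Δ fun j => c j) := by
  by_contra! h
  have h0 : comb Δ (fun j => (c j : ℝ)) = 0 := by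
    refine B.eq_zero ?_
    rw [B.form_comb]
    refine Finset.sum_nonpos fun j _ => ?_
    rcases eq_or_ne (c j) 0 with hj | hj
    · simp [hj]
    · exact mul_nonpos_of_nonneg_of_nonpos (Nat.cast_nonneg _) (h j hj)
  apply hc
  have := comb_injective Δ (h0.trans (map_zero (comb Δ)).symm)
  ext j
  simpa using congrFun this j

theorem one_le_of_coroot'_pos {x : V} (hx : x ∈ weightLattice Φ) {i : ι}
    (h : 0 < Φ.coroot' i x) : 1 ≤ Φ.coroot' i x := by
  obtain ⟨z, hz⟩ := hx i
  rw [hz] at h ⊢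
  exact_mod_cast h

/-- Every coroot takes a value at most `1`. -/
def IsCominuscule (x : V) : Prop :=
  ∀ k, Φ.coroot' k x ≤ 1

/-- Simple roots are peeled off one at a time. Some `αᵢ` in the support of `c` pairs positively with
the combination, hence with `x`; that pairing is then exactly `1`, and subtracting `αᵢ` is a
reflection. The bound is Weyl-invariant, so the induction continues although dominance of `x` may
fail. -/
theorem RootForm.form_self_eq_of_dominant_sub (B : RootForm Φ) [Finite ι]
    [Φ.IsCrystallographic] (n : ℕ) :
    ∀ (x : V) (c : Δ.support → ℕ), ∑ i, c i = n → x ∈ weightLattice Φ → IsCominuscule (Φ := Φ) x →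
      IsDominant Δ (x - comb Δ fun j => c j) →
      B.form (x - comb Δ fun j => c j) (x - comb Δ fun j => c j) = B.form x x := by
  classical
  induction n with
  | zero =>
    intro x c hn _ _ _
    have : c = 0 := by
      ext i
      simpa using (Finset.sum_eq_zero_iff.1 hn) i (Finset.mem_univ i)
    simp [this, comb_apply]
  | succ n ih =>
    intro x c hn hx hx1 hdom
    have hc : c ≠ 0 := by rintro rfl; simp at hn
    obtain ⟨i, hi, hpos⟩ := B.exists_coroot'_comb_pos Δ hc
    have h1 : Φ.coroot' i x = 1 := by
      refine le_antisymm (hx1 i) (one_le_of_coroot'_pos hx ?_)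
      have := hdom i i.2
      rw [map_sub] at this
      linarith
    have hs : RootPairing.weylGroup.ofIdx Φ i • x = x - Φ.root i := by
      rw [ofIdx_smul_eq, h1, one_smul]
    obtain ⟨c', rfl⟩ : ∃ c' : Δ.support → ℕ, c = c' + Pi.single i 1 := by
      refine ⟨fun j => c j - (Pi.single i 1 : Δ.support → ℕ) j, ?_⟩
      ext j
      rcases eq_or_ne j i with rfl | hj
      · simp only [Pi.add_apply, Pi.single_eq_same]
        omega
      · simp [hj]
    have hx' : x - comb Δ (fun j => ((c' + Pi.single i 1 : Δ.support → ℕ) j : ℝ)) =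
        RootPairing.weylGroup.ofIdx Φ i • x - comb Δ (fun j => (c' j : ℝ)) := by
      have : (fun j => ((c' + Pi.single i 1 : Δ.support → ℕ) j : ℝ)) =
          (fun j => (c' j : ℝ)) + Pi.single i 1 := by
        ext j
        rcases eq_or_ne j i with rfl | hj
        · simp
        · simp [hj]
      rw [this, map_add, comb_single, hs]
      abel
    rw [hx'] at hdom ⊢
    rw [ih _ c' ?_ (smul_mem_weightLattice _ hx) ?_ hdom, B.form_smul_smul]
    · simpa [Finset.sum_add_distrib] using hn
    · intro k
      obtain ⟨j, hj⟩ := B.exists_coroot'_smul (RootPairing.weylGroup.ofIdx Φ i) k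
      rw [hj]
      exact hx1 j

theorem RootForm.eq_zero_of_form_add_comb_self (B : RootForm Φ) {x : V} (hx : IsDominant Δ x)
    {c : Δ.support → ℕ}
    (h : B.form (x + comb Δ fun j => c j) (x + comb Δ fun j => c j) = B.form x x) : c = 0 := by
  rw [B.form_add_self] at h
  have h1 := B.form_comb_nonneg Δ (fun j => Nat.cast_nonneg (c j)) hx
  have h2 := B.eq_zero (x := comb Δ fun j => c j) (by linarith)
  have := comb_injective Δ (h2.trans (map_zero (comb Δ)).symm)
  ext j
  simpa using congrFun this j

theorem RootForm.eq_zero_of_dominant_sub (B : RootForm Φ) [Finite ι] [Φ.IsCrystallographic] {ω : V}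
    (hω : ω ∈ weightLattice Φ) (hω1 : IsCominuscule (Φ := Φ) ω)
    {c : Δ.support → ℕ} (hc : IsDominant Δ (ω - comb Δ fun j => c j)) : c = 0 := by
  refine B.eq_zero_of_form_add_comb_self Δ hc ?_
  rw [B.form_self_eq_of_dominant_sub Δ _ ω c rfl hω hω1 hc, sub_add_cancel]

/-- The negative part of `d` alone, subtracted from `ω`, still leaves a dominant vector: at each
simple coroot compare with `ω` or with `ω + ∑ dⱼ αⱼ`, according to the sign of the coefficient.
Hence that part vanishes. -/
theorem RootForm.nonneg_of_dominant_add_comb (B : RootForm Φ) [Finite ι] [Φ.IsCrystallographic]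
    {ω : V}
    (hω : ω ∈ weightLattice Φ) (hω1 : IsCominuscule (Φ := Φ) ω) (hω2 : IsDominant Δ ω)
    {d : Δ.support → ℤ} (hd : IsDominant Δ (ω + comb Δ fun j => d j)) (i : Δ.support) :
    0 ≤ d i := by
  have h : (fun j => (-d j).toNat) = 0 := by
    refine B.eq_zero_of_dominant_sub Δ hω hω1 fun j hj => ?_
    lift j to Δ.support using hj
    rcases le_total 0 (d j) with h | h
    · have := coroot'_comb_nonpos Δ (c := fun j => ((-d j).toNat : ℝ))
        (fun j => Nat.cast_nonneg _) (i := j) (by simp [h])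
      have := hω2 j j.2
      rw [map_sub]
      linarith
    · have h1 := coroot'_comb_nonpos Δ (c := fun j => ((d j).toNat : ℝ))
        (fun j => Nat.cast_nonneg _) (i := j) (by simp [h])
      have h2 := hd j j.2
      have h3 : ω - comb Δ (fun j => ((-d j).toNat : ℝ)) =
          (ω + comb Δ fun j => (d j : ℝ)) - comb Δ (fun j => ((d j).toNat : ℝ)) := by
        rw [add_sub_assoc, ← map_sub, sub_eq_add_neg, ← map_neg]
        congr 2
        ext k
        have := Int.toNat_sub_toNat_neg (d k)
        simp only [Pi.neg_apply, Pi.sub_apply]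
        have h4 : (d k : ℝ) = ((d k).toNat : ℝ) - ((-d k).toNat : ℝ) := by exact_mod_cast this.symm
        linarith
      rw [h3, map_sub]
      linarith
  have := congrFun h i
  simp at this
  omega

theorem RootForm.coroot'_ne_zero_of_simple_pos (B : RootForm Φ) {x : V}
    (hx : ∀ i : Δ.support, 0 < Φ.coroot' i x) (k : ι) : Φ.coroot' k x ≠ 0 := by
  have key : ∀ m : Δ.support → ℕ, comb Δ (fun j => (m j : ℝ)) ≠ 0 →
      0 < B.form (comb Δ fun j => m j) x := by
    intro m hm
    rw [B.form_comb]
    have : ∃ j, m j ≠ 0 := by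
      by_contra! h
      exact hm (by simp [h, comb_apply])
    obtain ⟨j, hj⟩ := this
    refine Finset.sum_pos' (fun k _ => mul_nonneg (Nat.cast_nonneg _) (hx k).le)
      ⟨j, Finset.mem_univ j, mul_pos (by positivity) (hx j)⟩
  obtain ⟨m, h | h⟩ := exists_root_eq_comb Δ k
  · rw [← B.root_apply, h]
    exact (key m (h ▸ Φ.ne_zero k)).ne'
  · rw [← B.root_apply, h, map_neg, LinearMap.neg_apply, neg_ne_zero]
    refine (key m fun h0 => Φ.ne_zero k ?_).ne'
    rw [h, h0, neg_zero]

/-- A dominant point of the orbit of `ρ + ω` is regular, so it stays dominant after subtracting `ρ`.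
It is therefore `ρ + ω` plus a nonnegative combination of simple roots, and equality of norms makes
this combination zero. -/
theorem RootForm.form_smul_le_of_dominant (B : RootForm Φ) [Finite ι] [Φ.IsRootSystem]
    [Φ.IsCrystallographic] {ρ ω v : V}
    (hρP : ρ ∈ weightLattice Φ) (hρ : IsUnitWeight Δ ρ)
    (hω : ω ∈ weightLattice Φ) (hω1 : IsCominuscule (Φ := Φ) ω) (hω2 : IsDominant Δ ω)
    (hv : IsDominant Δ v) (w : Φ.weylGroup) :
    B.form v (w • (ρ + ω)) ≤ B.form v (ρ + ω) := by
  obtain ⟨u, hu, hle⟩ := B.exists_dominant_smul Δ hρ hv (w • (ρ + ω))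
  suffices h : u • w • (ρ + ω) = ρ + ω by rwa [h] at hle
  rw [← mul_smul] at hu ⊢
  set t := u * w
  have hlam : ∀ i : Δ.support, 0 < Φ.coroot' i (ρ + ω) := fun i => by
    have := hω2 i i.2
    rw [map_add, hρ i]
    linarith
  have hP := add_mem hρP hω
  obtain ⟨d, hd⟩ := exists_comb_of_mem_rootLattice Δ (smul_sub_mem_rootLattice t hP)
  have ht : t • (ρ + ω) = ρ + ω + comb Δ fun j => d j := by rw [← hd]; abel
  have hd0 : ∀ i, 0 ≤ d i := by
    refine B.nonneg_of_dominant_add_comb Δ hω hω1 hω2 fun i hi => ?_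
    have h1 : 1 ≤ Φ.coroot' i (t • (ρ + ω)) := by
      refine one_le_of_coroot'_pos (smul_mem_weightLattice t hP) (lt_of_le_of_ne (hu i hi) ?_)
      obtain ⟨j, hj⟩ := B.exists_coroot'_smul t i
      rw [hj]
      exact (B.coroot'_ne_zero_of_simple_pos Δ hlam j).symm
    rw [ht, add_assoc, map_add, hρ ⟨i, hi⟩] at h1
    linarith
  lift d to Δ.support → ℕ using hd0
  have hz : d = 0 := by
    refine B.eq_zero_of_form_add_comb_self Δ (x := ρ + ω) (fun i hi => (hlam ⟨i, hi⟩).le) ?_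
    have := B.form_smul_smul t (ρ + ω) (ρ + ω)
    rw [ht] at this
    exact_mod_cast this
  rw [ht, hz]
  simp [comb_apply]

end Dominance

/-! ### From unsigned to positive firing -/

section Firing

variable {Φ : RootPairing ι ℝ V N}

/-- Central-firing along all roots rather than only the positive ones. -/
def UnsignedFires (Φ : RootPairing ι ℝ V N) (x y : V) : Prop :=
  ∃ i, Φ.coroot' i x = 0 ∧ y = x + Φ.root i

/-- The real span of all displacements reachable by unsigned central-firing. -/
def unsignedSpan (Φ : RootPairing ι ℝ V N) (x : V) : Submodule ℝ V :=
  Submodule.span ℝ {v | ∃ y, Relation.ReflTransGen (UnsignedFires Φ) x y ∧ v = y - x}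

theorem root_mem_unsignedSpan {x : V} {i : ι} (h : Φ.coroot' i x = 0) :
    Φ.root i ∈ unsignedSpan Φ x :=
  Submodule.subset_span ⟨x + Φ.root i, .single ⟨i, h, rfl⟩, by abel⟩

theorem unsignedSpan_add_root_le {x : V} {i : ι} (h : Φ.coroot' i x = 0) :
    unsignedSpan Φ (x + Φ.root i) ≤ unsignedSpan Φ x := by
  refine Submodule.span_le.2 ?_
  rintro _ ⟨y, hy, rfl⟩
  have h1 : y - x ∈ unsignedSpan Φ x :=
    Submodule.subset_span ⟨y, .head ⟨i, h, rfl⟩ hy, rfl⟩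
  have := sub_mem h1 (root_mem_unsignedSpan h)
  rwa [sub_sub] at this

theorem root_mem_firingSpan {Δ : Φ.Base} {μ ν : weightLattice Φ} {i : ι} (hi : Δ.IsPos i)
    (h0 : Φ.coroot' i (μ : V) = 0) (hν : (ν : V) = μ + Φ.root i) :
    Φ.root i ∈ firingSpan Δ μ := by
  rw [← neg_mem_iff]
  exact Submodule.subset_span ⟨ν, .single ⟨i, hi, h0, hν⟩, by rw [hν]; abel⟩

theorem firingSpan_le_of_fires {Δ : Φ.Base} {μ ν : weightLattice Φ} (h : Fires Δ μ ν) :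
    firingSpan Δ ν ≤ firingSpan Δ μ := by
  obtain ⟨i, hi, h0, hν⟩ := h
  refine Submodule.span_le.2 ?_
  rintro _ ⟨y, hy, rfl⟩
  have h1 : (μ : V) - y ∈ firingSpan Δ μ :=
    Submodule.subset_span ⟨y, .head ⟨i, hi, h0, hν⟩ hy, rfl⟩
  have := add_mem h1 (root_mem_firingSpan hi h0 hν)
  rw [hν]
  rwa [sub_add_eq_add_sub] at this

theorem RootForm.smul_sub_smul_mem_firingSpan (B : RootForm Φ) (Δ : Φ.Base)
    [Φ.IsCrystallographic] {x y : V} (h : Relation.ReflTransGen (UnsignedFires Φ) x y) :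
    ∀ (w : Φ.weylGroup) (μ : weightLattice Φ), (μ : V) = w • x →
      w • y - w • x ∈ firingSpan Δ μ := by
  induction h using Relation.ReflTransGen.head_induction_on with
  | refl => intro w μ _; rw [sub_self]; exact zero_mem _
  | @head x z hxz _ ih =>
    obtain ⟨i, hi, rfl⟩ := hxz
    have hzero : ∀ w : Φ.weylGroup, Φ.coroot' (Φ.weylGroupToPerm w i) (w • x) = 0 := fun w => by
      rw [← B.root_apply, ← RootPairing.weylGroup_apply_root, B.form_smul_smul, B.root_apply, hi]
    have hpos : ∀ (w : Φ.weylGroup) (μ : weightLattice Φ), (μ : V) = w • x →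
        Δ.IsPos (Φ.weylGroupToPerm w i) →
        w • Φ.root i ∈ firingSpan Δ μ ∧ w • y - w • x ∈ firingSpan Δ μ := by
      intro w μ hμ hp
      have hr := RootPairing.weylGroup_apply_root Φ w i
      have hz : w • (x + Φ.root i) ∈ weightLattice Φ := by
        rw [smul_add, ← hμ, hr]
        exact add_mem μ.2 (rootLattice_le_weightLattice (root_mem_rootLattice _))
      have hν : w • (x + Φ.root i) = μ + Φ.root (Φ.weylGroupToPerm w i) := by
        rw [smul_add, hμ, hr]
      have h0 : Φ.coroot' (Φ.weylGroupToPerm w i) (μ : V) = 0 := by rw [hμ, hzero]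
      have hroot := root_mem_firingSpan (ν := ⟨_, hz⟩) hp h0 hν
      rw [← hr] at hroot
      refine ⟨hroot, ?_⟩
      have := add_mem (firingSpan_le_of_fires ⟨_, hp, h0, hν⟩ (ih w ⟨_, hz⟩ rfl)) hroot
      rw [smul_add] at this
      convert this using 1
      abel
    intro w μ hμ
    set j := Φ.weylGroupToPerm w i with hj
    rcases RootPairing.Base.IsPos.or_neg Δ j with hp | hp
    · exact (hpos w μ hμ hp).2
    -- The reflection in `w • Φ.root i` fixes `w • x` and makes the fired root positive; the
    -- endpoint changes only by a multiple of that root, which is already in the span.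
    · set w' := RootPairing.weylGroup.ofIdx Φ j * w with hw'
      have hsx : w' • x = w • x := by rw [hw', mul_smul, ofIdx_smul_eq, hj, hzero]; simp
      have hroot : w' • Φ.root i = -Φ.root j := by
        rw [hw', mul_smul, RootPairing.weylGroup_apply_root, ofIdx_smul_eq, ← hj,
          coroot'_root_self, two_smul]
        abel
      have hp' : Δ.IsPos (Φ.weylGroupToPerm w' i) := by
        convert hp
        apply Φ.root.injective
        rw [← RootPairing.weylGroup_apply_root, hroot]
        simp
      obtain ⟨h1, h2⟩ := hpos w' μ (hμ.trans hsx.symm) hp'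
      rw [hroot, neg_mem_iff] at h1
      rw [hsx, hw', mul_smul, ofIdx_smul_eq] at h2
      have := add_mem h2 (Submodule.smul_mem _ (Φ.coroot' j (w • y)) h1)
      convert this using 1
      abel

theorem RootForm.smul_mem_firingSpan (B : RootForm Φ) (Δ : Φ.Base) [Φ.IsCrystallographic]
    (w : Φ.weylGroup) {x v : V} (hv : v ∈ unsignedSpan Φ x) {μ : weightLattice Φ}
    (hμ : (μ : V) = w • x) : w • v ∈ firingSpan Δ μ := by
  induction hv using Submodule.span_induction with
  | mem v hv =>
    obtain ⟨y, hy, rfl⟩ := hv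
    rw [smul_sub]
    exact B.smul_sub_smul_mem_firingSpan Δ hy w μ hμ
  | zero => rw [smul_zero]; exact zero_mem _
  | add x y _ _ hx hy => rw [smul_add]; exact add_mem hx hy
  | smul a x _ hx => rw [smul_comm]; exact Submodule.smul_mem _ a hx

end Firing

/-! ### The span reached from a dominant weight -/

section Span

variable {Φ : RootPairing ι ℝ V N}

theorem RootForm.coroot'_root_gt_neg_two (B : RootForm Φ) {i j : ι}
    (h : Φ.root i + Φ.root j ≠ 0) : -2 < Φ.coroot' i (Φ.root j) := by
  have := B.pos _ h
  rw [B.form_add_self, B.root_apply, B.root_apply, B.root_apply, coroot'_root_self,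
    coroot'_root_self] at this
  linarith

theorem RootForm.coroot'_root_lt_two (B : RootForm Φ) {i j : ι}
    (h : Φ.root i ≠ Φ.root j) : Φ.coroot' i (Φ.root j) < 2 := by
  have := B.pos (Φ.root i + -Φ.root j) (by rwa [← sub_eq_add_neg, sub_ne_zero])
  rw [B.form_add_self] at this
  simp only [map_neg, LinearMap.neg_apply, B.root_apply, coroot'_root_self] at this
  linarith

theorem exists_coroot'_root_eq [Φ.IsCrystallographic] (i j : ι) :
    ∃ z : ℤ, Φ.coroot' i (Φ.root j) = z :=
  rootLattice_le_weightLattice (root_mem_rootLattice j) i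

theorem RootForm.coroot'_eq_sum (B : RootForm Φ) (Δ : Φ.Base) {k : ι} {m : Δ.support → ℝ}
    (h : Φ.root k = comb Δ m) (x : V) : Φ.coroot' k x = ∑ i, m i * Φ.coroot' i x := by
  rw [← B.root_apply, h, B.form_comb]

theorem IsUnitWeight.mem_weightLattice (B : RootForm Φ) {Δ : Φ.Base} {ρ : V}
    (hρ : IsUnitWeight Δ ρ) : ρ ∈ weightLattice Φ := by
  intro k
  obtain ⟨m, h | h⟩ := exists_root_eq_comb Δ k
  · exact ⟨∑ i, (m i : ℤ), by simp [B.coroot'_eq_sum Δ h, hρ _]⟩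
  · refine ⟨-∑ i, (m i : ℤ), ?_⟩
    rw [← B.root_apply, h, map_neg, LinearMap.neg_apply, B.form_comb]
    simp [hρ _]

/-- If some coroot vanishes at a dominant weight `x`, then some positive root orthogonal to `x`
can be added to `x` without leaving the dominant chamber. -/
theorem RootForm.exists_root_add_dominant (B : RootForm Φ) (Δ : Φ.Base) [Finite ι]
    [Φ.IsCrystallographic] {ρ x : V} (hρ : IsUnitWeight Δ ρ) (hxP : x ∈ weightLattice Φ)
    (hx : IsDominant Δ x) (h : ∃ k, Φ.coroot' k x = 0) :
    ∃ (k : ι) (m : Δ.support → ℕ), Φ.coroot' k x = 0 ∧ Φ.root k = comb Δ (fun j => m j) ∧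
      IsDominant Δ (x + Φ.root k) := by
  -- Pairing with `ρ` measures height: take a highest root orthogonal to `x`.
  obtain ⟨k, hk, hmax⟩ := Set.exists_max_image {k | Φ.coroot' k x = 0} (fun k => Φ.coroot' k ρ)
    (Set.toFinite _) h
  have hk : Φ.coroot' k x = 0 := hk
  have hrefl : ∀ i, ∃ l, Φ.root l = Φ.root k - Φ.coroot' i (Φ.root k) • Φ.root i := fun i =>
    ⟨Φ.reflectionPerm i k, by rw [Φ.root_reflectionPerm, Φ.reflection_apply]⟩
  obtain ⟨m, hm⟩ : ∃ m : Δ.support → ℕ, Φ.root k = comb Δ (fun j => m j) := by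
    obtain ⟨m, hm | hm⟩ := exists_root_eq_comb Δ k
    · exact ⟨m, hm⟩
    · exfalso
      obtain ⟨l, hl⟩ := hrefl k
      rw [coroot'_root_self, two_smul, sub_add_cancel_left] at hl
      have h1 : ∀ y, Φ.coroot' l y = -Φ.coroot' k y := fun y => by
        rw [← B.root_apply, hl, map_neg, LinearMap.neg_apply, B.root_apply]
      have h2 : Φ.coroot' k ρ ≠ 0 :=
        B.coroot'_ne_zero_of_simple_pos Δ (fun i => by rw [hρ i]; exact one_pos) k
      have h3 : Φ.coroot' k ρ ≤ 0 := by
        rw [← B.root_apply, hm, map_neg, LinearMap.neg_apply, B.form_comb, neg_nonpos]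
        exact Finset.sum_nonneg fun i _ => by rw [hρ i]; positivity
      have h4 := hmax l (show Φ.coroot' l x = 0 by rw [h1, hk, neg_zero])
      simp only [h1] at h4
      exact h2 (by linarith)
  refine ⟨k, m, hk, hm, fun i hi => ?_⟩
  lift i to Δ.support using hi
  have hgt : -2 < Φ.coroot' i (Φ.root k) := by
    refine B.coroot'_root_gt_neg_two fun h0 => ?_
    classical
    rw [hm, ← comb_single, ← map_add] at h0
    have := congrFun (comb_injective Δ (h0.trans (map_zero (comb Δ)).symm)) i
    simp at this
    have : (0:ℝ) ≤ m i := Nat.cast_nonneg _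
    linarith
  obtain ⟨z, hz⟩ := exists_coroot'_root_eq (Φ := Φ) i k
  obtain ⟨a, ha⟩ := hxP i
  have hx0 := hx i i.2
  rw [map_add, hz, ha]
  rw [hz] at hgt
  rw [ha] at hx0
  norm_cast at hgt hx0 ⊢
  -- Failure leaves only `⟨x, αᵢ^∨⟩ = 0` and `⟨αₖ, αᵢ^∨⟩ = -1`; then `αₖ + αᵢ` is a higher root
  -- orthogonal to `x`.
  by_contra! hneg
  obtain rfl : a = 0 := by omega
  obtain rfl : z = -1 := by omega
  obtain ⟨l, hl⟩ := hrefl i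
  rw [hz] at hl
  have h1 : ∀ y, Φ.coroot' l y = Φ.coroot' k y + Φ.coroot' i y := fun y => by
    rw [← B.root_apply, hl]
    simp [B.root_apply]
  have h4 := hmax l (show Φ.coroot' l x = 0 by rw [h1, hk, ha]; simp)
  simp only [h1, hρ i] at h4
  linarith

theorem RootForm.root_mem_unsignedSpan_of_dominant (B : RootForm Φ) (Δ : Φ.Base) [Finite ι]
    [Φ.IsCrystallographic] {ρ ω : V} (hρ : IsUnitWeight Δ ρ)
    (hω : ω ∈ weightLattice Φ) (hω1 : IsCominuscule (Φ := Φ) ω) (hω2 : IsDominant Δ ω) (n : ℕ) :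
    ∀ c : Δ.support → ℕ, ∑ i, c i = n → IsDominant Δ (ρ + ω - comb Δ fun j => c j) →
      ∀ i, c i ≠ 0 → Φ.root i ∈ unsignedSpan Φ (ρ + ω - comb Δ fun j => c j) := by
  induction n using Nat.strong_induction_on with
  | _ n ih =>
  intro c hn hdom i hi
  set x := ρ + ω - comb Δ (fun j => (c j : ℝ)) with hx
  have hρP := hρ.mem_weightLattice B
  have hxP : x ∈ weightLattice Φ := by
    refine sub_mem (add_mem hρP hω) (rootLattice_le_weightLattice ?_)
    exact_mod_cast comb_mem_rootLattice Δ (fun j => (c j : ℤ))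
  have hsing : ∃ k, Φ.coroot' k x = 0 := by
    by_contra! hreg
    refine hi (congrFun (B.eq_zero_of_dominant_sub Δ hω hω1 (c := c) fun j hj => ?_) i)
    have h1 := one_le_of_coroot'_pos hxP (lt_of_le_of_ne (hdom j hj) (hreg j).symm)
    rw [hx, add_sub_assoc, map_add, hρ ⟨j, hj⟩] at h1
    linarith
  obtain ⟨k, m, hk, hm, hdom'⟩ := B.exists_root_add_dominant Δ hρ hxP hdom hsing
  have hsupp : ∀ j, m j ≠ 0 → Φ.coroot' j x = 0 := by
    intro j hj
    rw [B.coroot'_eq_sum Δ hm, Finset.sum_eq_zero_iff_of_nonneg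
      fun (j : Δ.support) _ => mul_nonneg (Nat.cast_nonneg _) (hdom j j.2)] at hk
    simpa [hj] using hk j (Finset.mem_univ j)
  have hlam : ∀ j : Δ.support, 1 ≤ Φ.coroot' j (ρ + ω) := fun j => by
    rw [map_add, hρ j]
    linarith [hω2 j j.2]
  have hzero : ∀ j : Δ.support, Φ.coroot' j x = 0 → c j ≠ 0 := by
    intro j hj hc
    have := coroot'_comb_nonpos Δ (c := fun j => (c j : ℝ)) (fun _ => Nat.cast_nonneg _)
      (i := j) (by simp [hc])
    rw [hx, map_sub] at hj
    linarith [hlam j]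
  -- Firing must not overshoot `ρ + ω`. Where `c l < m l`, the coroot vanishes at `x`, so it is at
  -- least `1` on `∑ cⱼ αⱼ`; it is at most `1` on the fired root unless that root is `αₗ`, which
  -- would force `c l = 0`.
  have hle : ∀ j, m j ≤ c j := by
    intro j
    have := B.nonneg_of_coroot'_comb_nonneg Δ (d := (fun j => (c j : ℝ)) - fun j => (m j : ℝ))
      (fun l hl => ?_) j
    · simpa using this
    have hl : c l < m l := by simpa using hl
    have hxl := hsupp l (by omega)
    have hne : Φ.root l ≠ Φ.root k := by
      intro e
      classical
      rw [hm, ← comb_single] at e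
      have := congrFun (comb_injective Δ e) l
      simp at this
      have : m l = 1 := by exact_mod_cast this.symm
      exact hzero l hxl (by omega)
    have h2 : Φ.coroot' l (Φ.root k) ≤ 1 := by
      have := B.coroot'_root_lt_two hne
      obtain ⟨z, hz⟩ := exists_coroot'_root_eq (Φ := Φ) l k
      rw [hz] at this ⊢
      norm_cast at this ⊢
      omega
    have h3 := hxl
    rw [hx, map_sub] at h3
    rw [map_sub, map_sub, ← hm]
    linarith [hlam l]
  have hsum : ∑ j, (c j - m j) < n := by
    rw [← hn]
    obtain ⟨l, hl⟩ : ∃ l, m l ≠ 0 := by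
      by_contra! h0
      exact Φ.ne_zero k (by rw [hm]; simp [h0, comb_apply])
    exact Finset.sum_lt_sum (fun j _ => Nat.sub_le _ _)
      ⟨l, Finset.mem_univ l, by have := hle l; omega⟩
  have hx' : x + Φ.root k = ρ + ω - comb Δ (fun j => ((c j - m j : ℕ) : ℝ)) := by
    have : (fun j => ((c j - m j : ℕ) : ℝ)) = (fun j => (c j : ℝ)) - fun j => (m j : ℝ) := by
      ext j
      simp [Nat.cast_sub (hle j)]
    rw [this, map_sub, hx, hm]
    abel
  rcases eq_or_ne (m i) 0 with h0 | h0
  · refine unsignedSpan_add_root_le hk ?_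
    rw [hx'] at hdom' ⊢
    exact ih _ hsum _ rfl hdom' i (by simpa [h0] using hi)
  · exact root_mem_unsignedSpan (hsupp i h0)

end Span

/-! ### The rescaled inner product -/

section Euclidean

variable {ι V N : Type*} [NormedAddCommGroup V] [InnerProductSpace ℝ V]
  [AddCommGroup N] [Module ℝ N] {Φ : RootPairing ι ℝ V N}

/-- The rescaled inner product in which every root has squared length `2`. -/
def RootForm.ofInner (hΦ : IsEuclidean Φ) (hlaced : IsSimplyLaced Φ) (k : ι) : RootForm Φ where
  form := (2 / ⟪Φ.root k, Φ.root k⟫_ℝ) • innerₗ V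
  symm x y := by simp [real_inner_comm]
  pos x hx := by
    have h1 : 0 < ⟪Φ.root k, Φ.root k⟫_ℝ := real_inner_self_pos.2 (Φ.ne_zero k)
    have h2 : 0 < ⟪x, x⟫_ℝ := real_inner_self_pos.2 hx
    simp only [LinearMap.smul_apply, innerₗ_apply_apply, smul_eq_mul]
    positivity
  root_apply i v := by
    rw [hΦ i v, real_inner_self_eq_norm_sq, real_inner_self_eq_norm_sq, hlaced k i]
    simp only [LinearMap.smul_apply, innerₗ_apply_apply, smul_eq_mul]
    ring

end Euclidean

/-! ### Minuscule weights and the Weyl vector -/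

section Permutohedron

variable {Φ : RootPairing ι ℝ V N}

/-- If a pairing `c` exceeded `1`, then `ω - α` would lie on the segment from `ω` to its reflection,
hence in the orbit; but its norm equals that of `ω` only when `c = 1`. -/
theorem RootForm.isCominuscule_of_isMinuscule (B : RootForm Φ) {Δ : Φ.Base} {ω : V}
    (hω : IsMinuscule Δ ω) : IsCominuscule (Φ := Φ) ω := by
  intro k
  by_contra! hk
  set c := Φ.coroot' k ω with hc
  have hc0 : 0 < c := by linarith
  have hmem : ω - Φ.root k ∈ permutohedronLattice Φ ω := by
    refine ⟨?_, by simpa using root_mem_rootLattice k⟩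
    have h1 : ω ∈ permutohedron Φ ω := subset_convexHull ℝ _ (MulAction.mem_orbit_self ω)
    have h2 : ω - c • Φ.root k ∈ permutohedron Φ ω := by
      rw [hc, ← ofIdx_smul_eq]
      exact subset_convexHull ℝ _ (MulAction.mem_orbit _ _)
    have h3 : c⁻¹ ≤ 1 := inv_le_one_of_one_le₀ hk.le
    have := convex_convexHull ℝ _ h1 h2 (a := 1 - c⁻¹) (b := c⁻¹) (by linarith)
      (by positivity) (by ring)
    convert! this using 1
    rw [smul_sub, smul_smul, inv_mul_cancel₀ hc0.ne', sub_smul, one_smul, one_smul]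
    abel
  rw [hω.2.2.2] at hmem
  obtain ⟨w, hw⟩ := hmem
  have hw : w • ω = ω - Φ.root k := hw
  have h := B.form_smul_smul w ω ω
  rw [hw, sub_eq_add_neg, B.form_add_self] at h
  simp only [map_neg, LinearMap.neg_apply, B.symm ω, B.root_apply, coroot'_root_self] at h
  linarith

theorem coroot'_weylVector [Φ.IsRootSystem] (Δ : Φ.Base) : IsUnitWeight Δ (weylVector Δ) := by
  classical
  intro j
  rw [weylVector, map_sum]
  simp only [coroot_fundamentalWeight, Finset.sum_ite_eq', Finset.mem_univ, if_true]

end Permutohedron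

/-! ### Strict inequalities at interior points -/

section Interior

variable {ι V N : Type*} [NormedAddCommGroup V] [InnerProductSpace ℝ V]
  [AddCommGroup N] [Module ℝ N] {Φ : RootPairing ι ℝ V N}

theorem exists_pos_add_smul_mem_of_mem_interior {s : Set V} {x : V} (hx : x ∈ interior s) (v : V) :
    ∃ ε : ℝ, 0 < ε ∧ x + ε • v ∈ s := by
  have hc : ContinuousAt (fun t : ℝ => x + t • v) 0 := by fun_prop
  have h : ∀ᶠ t in nhds (0 : ℝ), x + t • v ∈ s :=
    hc (by simpa using mem_interior_iff_mem_nhds.1 hx)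
  obtain ⟨ε, hε, hb⟩ := Metric.eventually_nhds_iff.1 h
  exact ⟨ε / 2, half_pos hε, hb (by simp [abs_of_pos hε, hε])⟩

/-- A small step in the direction `u⁻¹ • v` stays inside the permutohedron and strictly increases
the functional, so its bound is not attained at `x`. -/
theorem RootForm.form_smul_lt_of_mem_interior (B : RootForm Φ) (Δ : Φ.Base) [Finite ι]
    [Φ.IsRootSystem] [Φ.IsCrystallographic] {ρ ω v x : V} (hρ : IsUnitWeight Δ ρ)
    (hω : ω ∈ weightLattice Φ) (hω1 : IsCominuscule (Φ := Φ) ω) (hω2 : IsDominant Δ ω)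
    (hv : IsDominant Δ v) (hv0 : v ≠ 0) (hx : x ∈ interior (permutohedron Φ (ρ + ω)))
    (u : Φ.weylGroup) : B.form v (u • x) < B.form v (ρ + ω) := by
  have hle : permutohedron Φ (ρ + ω) ⊆ {z | B.form (u⁻¹ • v) z ≤ B.form v (ρ + ω)} := by
    refine convexHull_min ?_ (convex_halfSpace_le (B.form (u⁻¹ • v)).isLinear _)
    rintro _ ⟨w, rfl⟩
    change B.form (u⁻¹ • v) (w • (ρ + ω)) ≤ _
    rw [B.form_smul, inv_inv, ← mul_smul]
    exact B.form_smul_le_of_dominant Δ (hρ.mem_weightLattice B) hρ hω hω1 hω2 hv _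
  obtain ⟨ε, hε, hmem⟩ := exists_pos_add_smul_mem_of_mem_interior hx (u⁻¹ • v)
  have h : B.form (u⁻¹ • v) (x + ε • u⁻¹ • v) ≤ B.form v (ρ + ω) := hle hmem
  rw [map_add, (B.form (u⁻¹ • v)).map_smul, B.form_smul_smul, B.form_smul, inv_inv, smul_eq_mul] at h
  have := mul_pos hε (B.pos v hv0)
  linarith

end Interior

end CentralFiring

end

/-! ### The main theorem -/

open CentralFiring in
theorem mainTheorem7 {ι V N : Type*} [Finite ι]
    [NormedAddCommGroup V] [InnerProductSpace ℝ V] [AddCommGroup N] [Module ℝ N]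
    (Φ : RootPairing ι ℝ V N) [Φ.IsRootSystem] [Φ.IsCrystallographic] [Φ.IsReduced]
    [Φ.IsIrreducible] (hΦ : CentralFiring.IsEuclidean Φ)
    (hlaced : CentralFiring.IsSimplyLaced Φ) (Δ : Φ.Base)
    (ω : V) (hω : ω = 0 ∨ CentralFiring.IsMinuscule Δ ω)
    (lam : CentralFiring.weightLattice Φ)
    (hlam : (lam : V) ∈
      CentralFiring.interiorPermutohedronLattice Φ (CentralFiring.weylVector Δ + ω)) :
    CentralFiring.IsConnectedWeight Δ lam := by
  classical
  have : Nontrivial V := RootPairing.IsIrreducible.nontrivial Φ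
  obtain ⟨k⟩ : Nonempty ι := by
    by_contra h
    rw [not_nonempty_iff] at h
    have := RootPairing.IsRootSystem.span_root_eq_top (P := Φ)
    rw [Set.range_eq_empty, Submodule.span_empty] at this
    exact bot_ne_top this
  let B := RootForm.ofInner hΦ hlaced k
  obtain ⟨hωP, hω1, hω2⟩ : ω ∈ weightLattice Φ ∧ IsCominuscule (Φ := Φ) ω ∧ IsDominant Δ ω := by
    rcases hω with rfl | h
    · exact ⟨zero_mem _, fun k => by simp, fun i _ => by simp⟩
    · exact ⟨h.1, B.isCominuscule_of_isMinuscule h, h.2.2.1⟩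
  have hρ := coroot'_weylVector Δ
  -- With `v = 0` this only selects a dominant point of the orbit.
  obtain ⟨u, hu, -⟩ := B.exists_dominant_smul Δ hρ (v := 0) (fun i _ => by simp) (lam : V)
  obtain ⟨d, hd⟩ := exists_comb_of_mem_rootLattice Δ
    (add_mem (smul_sub_mem_rootLattice u lam.2) hlam.2)
  rw [sub_add_sub_cancel] at hd
  -- Pairing with the `i`-th fundamental weight reads off `d i`; interiority gives strictness, so
  -- every simple root occurs.
  have hneg : ∀ i, d i < 0 := by
    intro i
    have hfund := coroot_fundamentalWeight Δ i
    have h := B.form_smul_lt_of_mem_interior Δ hρ hωP hω1 hω2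
      (v := fundamentalWeight Δ i) (fun j hj => by
        rw [hfund ⟨j, hj⟩]; split_ifs <;> norm_num)
      (fun h0 => by simpa [h0] using hfund i) hlam.1 u
    have h2 : B.form (fundamentalWeight Δ i) (u • (lam : V) - (weylVector Δ + ω)) = d i := by
      rw [hd, B.symm, B.form_comb]
      simp [hfund]
    rw [map_sub] at h2
    have : (d i : ℝ) < 0 := by linarith
    exact_mod_cast this
  set c : Δ.support → ℕ := fun i => (-d i).toNat with hc
  have hlamc : u • (lam : V) = weylVector Δ + ω - comb Δ fun j => (c j : ℝ) := by
    have : (fun j => (c j : ℝ)) = -fun j => (d j : ℝ) := by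
      ext j
      have : ((c j : ℤ)) = -d j := Int.toNat_of_nonneg (by linarith [hneg j])
      simp only [Pi.neg_apply]
      exact_mod_cast this
    rw [this, map_neg, ← hd]
    abel
  rw [hlamc] at hu
  have hspan : unsignedSpan Φ (u • (lam : V)) = ⊤ := by
    rw [eq_top_iff, ← Δ.toWeightBasis.span_eq, Submodule.span_le]
    rintro _ ⟨i, rfl⟩
    rw [Δ.toWeightBasis_apply, hlamc]
    exact B.root_mem_unsignedSpan_of_dominant Δ hρ hωP hω1 hω2 _ c rfl hu i
      (by have := hneg i; simp only [hc]; omega)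
  rw [IsConnectedWeight, eq_top_iff]
  intro v _
  have := B.smul_mem_firingSpan Δ u⁻¹ (x := u • (lam : V)) (v := u • v)
    (by rw [hspan]; trivial) (μ := lam) (inv_smul_smul u _).symm
  rwa [inv_smul_smul] at this
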